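/- Let $\mathbb{M}_n$ denote the algebra of $n\times n$ complex matrices, ordered by the Loewner order ($X\le Y$ iff $Y-X$ is positive semidefinite), and let $p,q\in\mathbb{R}$. For a unital (i.e. $\Phi(I)=I$) completely positive linear map $\Phi:\mathbb{M}_3\to\mathbb{M}_2$ and a positive definite $A\in\mathbb{M}_3$, powers and logarithms are taken by functional calculus, and $\Phi(A^p)^{1/p}$ is read as $\exp(\Phi(\log A))$ when $p=0$. Suppose that $$\Phi(A^p)^{1/p}\le\Phi(A^q)^{1/q}$$ holds for every unital completely positive linear map $\Phi:\mathbb{M}_3\to\mathbb{M}_2$ and every positive definite matrix $A\in\mathbb{M}_3$. Then $(p,q)$ satisfies at least one of the following conditions: $$p=q;\qquad 1\le p<q;\qquad p<q\le-1;\qquad p\le-1,\ q\ge1;\qquad \tfrac12\le p<1\le q;\qquad p\le-1<q\le-\tfrac12 .$$ -/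

import Mathlib

open scoped CStarAlgebra MatrixOrder ComplexOrder Matrix.Norms.L2Operator

/-- The quasi-arithmetic expression `Φ(A^p)^{1/p}` attached to a completely positive linear map
`Φ : M_n(ℂ) → M_m(ℂ)`, a real parameter `p` and a matrix `A`; for `p = 0` it is
`exp (Φ (log A))`. Real powers and the logarithm are those of the continuous functional calculus.
It is meant for unital `Φ` and positive definite `A`, for which `A` and `Φ(A^p)` are both
positive definite. -/
noncomputable def powerMean {n m : ℕ}
    (Φ : Matrix (Fin n) (Fin n) ℂ →CP Matrix (Fin m) (Fin m) ℂ) (p : ℝ)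
    (A : Matrix (Fin n) (Fin n) ℂ) : Matrix (Fin m) (Fin m) ℂ :=
  if p = 0 then NormedSpace.exp (Φ (CFC.log A)) else (Φ (A ^ p)) ^ (1 / p)

/-! Since inversion reverses the order, replacing `A` by `A⁻¹` turns the inequality for `(p, q)`
into that for `(-q, -p)`. Scalar power means of `2` and `1` force `p ≤ q`. It then suffices to show
that the inequality fails whenever `-1 < p < 1/2` and `p < q`: applied to `(p, q)` and to `(-q,
-p)`, this leaves exactly the listed cases.

For the failure, `A = diag(2, 1, c)` is compressed by isometries depending on `s`. With `e = (2^r +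
1)/2` and `b = (2^r - 1)/2`, `Φ(A^r)` has diagonal `s e + (1 - s) c^r, e` and off-diagonal entry `√s
b`, and the lower right entries of the two means are compared as `c → ∞`. For `q > 0` that of `q` is
`O(s c^(1-2q) + 1)` (`meanEntry_le_of_pos`), while that of `p` grows faster: like `c^(1-2p)` for `0
< p < 1/2`, at least like `c^(1-2s)` for `p = 0`, and like `c^(p+1)` with `s = c^p` for `-1 < p <
0`. For `q < 0` and `s = c^(-ν)` both entries have order `c^(1-ν)`, and the leading coefficients
`(b/e)²` are in the wrong order. The case `q = 0` follows by inversion. -/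

/-! ### Complete positivity of compressions -/

/-- The compression `X ↦ Vᴴ X V` as a completely positive map. -/
noncomputable def compression {n m : ℕ} [NeZero m] (V : Matrix (Fin n) (Fin m) ℂ) :
    Matrix (Fin n) (Fin n) ℂ →CP Matrix (Fin m) (Fin m) ℂ where
  toFun X := V.conjTranspose * X * V
  map_add' X Y := by rw [Matrix.mul_add, Matrix.add_mul]
  map_smul' c X := by simp
  map_cstarMatrix_nonneg' k M hM := by
    change 0 ≤ M.map (fun X => V.conjTranspose * X * V)
    rw [StarOrderedRing.nonneg_iff] at hM
    induction hM using AddSubmonoid.closure_induction with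
    | mem M hM =>
      obtain ⟨N, rfl⟩ := hM
      -- The blocks `N l j * V` are rectangular. Each of their rows is placed as row `0` of a square
      -- block, so that the compressed matrix becomes a sum of squares `star (Y r) * Y r`.
      let Y : Fin n → CStarMatrix (Fin k) (Fin k) (Matrix (Fin m) (Fin m) ℂ) := fun r =>
        CStarMatrix.ofMatrix fun l j => Matrix.of fun a b => if a = 0 then (N l j * V) r b else 0
      have hY : ∀ r l j c b, Y r l j c b = if c = 0 then (N l j * V) r b else 0 :=
        fun _ _ _ _ _ => rfl
      have key : (star N * N).map (fun X => V.conjTranspose * X * V) = ∑ r, star (Y r) * Y r := by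
        ext i j a b
        have h1 : (∑ r, star (Y r) * Y r) i j = ∑ r, (star (Y r) * Y r) i j :=
          (congrFun (Finset.sum_apply i _ _) j).trans (Finset.sum_apply j _ _)
        rw [h1, CStarMatrix.map_apply, Matrix.sum_apply, CStarMatrix.mul_apply,
          Matrix.mul_sum, Matrix.sum_mul, Matrix.sum_apply]
        simp_rw [CStarMatrix.mul_apply, Matrix.sum_apply]
        rw [Finset.sum_comm]
        refine Finset.sum_congr rfl fun l _ => ?_
        have h2 : V.conjTranspose * ((star N) i l * N l j) * V
            = (N l i * V).conjTranspose * (N l j * V) := by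
          rw [Matrix.conjTranspose_mul, CStarMatrix.star_apply, Matrix.star_eq_conjTranspose]
          simp only [Matrix.mul_assoc]
        rw [h2, Matrix.mul_apply]
        refine Finset.sum_congr rfl fun r _ => ?_
        rw [Matrix.mul_apply (M := star (Y r) i l), Finset.sum_eq_single 0]
        · simp [hY, CStarMatrix.star_apply]
        · intro c _ hc
          simp [hY, hc]
        · simp
      simp only
      rw [key]
      exact Finset.sum_nonneg fun r _ => star_mul_self_nonneg _
    | zero =>
      refine le_of_eq ?_
      ext i j a b
      simp [CStarMatrix.map_apply]
    | add M N _ _ hM hN =>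
      have : (M + N).map (fun X => V.conjTranspose * X * V)
          = M.map (fun X => V.conjTranspose * X * V) + N.map (fun X => V.conjTranspose * X * V) := by
        ext i j a b
        simp [CStarMatrix.map_apply, Matrix.mul_add, Matrix.add_mul]
      rw [this]
      exact add_nonneg hM hN

theorem compression_apply {n m : ℕ} [NeZero m] (V : Matrix (Fin n) (Fin m) ℂ)
    (X : Matrix (Fin n) (Fin n) ℂ) : compression V X = V.conjTranspose * X * V := rfl

theorem compression_one {n m : ℕ} [NeZero m] (V : Matrix (Fin n) (Fin m) ℂ)
    (h : V.conjTranspose * V = 1) : compression V 1 = 1 := by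
  simp [compression_apply, h]

/-! ### Functional calculus of diagonal and of `2 × 2` symmetric matrices -/

theorem cfc_diagonal_ofReal (f : ℝ → ℝ) {n : ℕ} (d : Fin n → ℝ) :
    cfc f (Matrix.diagonal (fun i => (d i : ℂ))) = Matrix.diagonal (fun i => (f (d i) : ℂ)) := by
  set D : Matrix (Fin n) (Fin n) ℂ := Matrix.diagonal (fun i => (d i : ℂ)) with hD
  have hsa : IsSelfAdjoint D := by
    rw [IsSelfAdjoint, Matrix.star_eq_conjTranspose, Matrix.diagonal_conjTranspose]
    congr 1
    ext i
    simp
  have hs : ∀ t ∈ spectrum ℝ D, t ∈ Finset.univ.image d := by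
    intro t ht
    rw [← spectrum.algebraMap_mem_iff ℂ, spectrum_diagonal] at ht
    obtain ⟨i, hi⟩ := ht
    simp only [Finset.mem_image, Finset.mem_univ, true_and]
    exact ⟨i, Complex.ofReal_injective hi⟩
  -- On a finite spectrum `f` agrees with an interpolating polynomial, which commutes with the
  -- algebra homomorphism from diagonals to matrices.
  set P := Lagrange.interpolate (Finset.univ.image d) id f with hP
  have hPe : ∀ t ∈ Finset.univ.image d, P.eval t = f t := fun t ht =>
    Lagrange.eval_interpolate_at_node f (Function.injective_id.injOn) ht
  rw [cfc_congr (g := P.eval) (fun t ht => (hPe t (hs t ht)).symm), cfc_polynomial P D hsa]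
  have h1 : D = Matrix.diagonalAlgHom ℝ (fun i => (d i : ℂ)) := rfl
  rw [h1, Polynomial.aeval_algHom_apply]
  change Matrix.diagonal _ = _
  congr 1
  ext i
  rw [Polynomial.aeval_pi_apply, ← hPe (d i) (by simp)]
  exact (Polynomial.aeval_algebraMap_apply ℂ (d i) P)

/-- The spectrum lies in `{x, y}`, so `f` may be replaced by the affine function agreeing with it at
these two points. -/
theorem cfc_eq_of_mul_eq_zero {A : Type*} [CStarAlgebra A] (f : ℝ → ℝ) {S : A}
    (hS : IsSelfAdjoint S) {x y : ℝ} (hxy : x ≠ y)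
    (h : (S - algebraMap ℝ A x) * (S - algebraMap ℝ A y) = 0) :
    cfc f S = algebraMap ℝ A (f y) + ((f x - f y) / (x - y)) • (S - algebraMap ℝ A y) := by
  have hs : ∀ t ∈ spectrum ℝ S, t = x ∨ t = y := by
    intro t ht
    have h2 := spectrum.subset_polynomial_aeval S
      ((Polynomial.X - Polynomial.C x) * (Polynomial.X - Polynomial.C y)) ⟨t, ht, rfl⟩
    have h3 : Nontrivial A := by
      by_contra hA
      rw [not_nontrivial_iff_subsingleton] at hA
      simp at ht
    simp [h, sub_eq_zero] at h2
    exact h2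
  have : cfc f S = cfc (fun t => f y + ((f x - f y) / (x - y)) * (t - y)) S := by
    apply cfc_congr
    intro t ht
    have : x - y ≠ 0 := sub_ne_zero.mpr hxy
    rcases hs t ht with rfl | rfl
    · simp; field_simp; ring
    · simp
  rw [this, cfc_const_add (f y) (fun t => ((f x - f y) / (x - y)) * (t - y)) S,
    cfc_const_mul _ (fun t => t - y) S, cfc_sub (fun t => t) (fun _ => y) S,
    cfc_id' ℝ S, cfc_const y S]

theorem diag_re_le {n : ℕ} {X Y : Matrix (Fin n) (Fin n) ℂ} (h : X ≤ Y) (i : Fin n) :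
    (X i i).re ≤ (Y i i).re := by
  have := (Matrix.le_iff.mp h).diag_nonneg (i := i)
  simpa using (Complex.le_def.mp this).1

/-- The real symmetric matrix with rows `(α, β)` and `(β, δ)`, as a complex matrix. -/
noncomputable def symMatrix (α β δ : ℝ) : Matrix (Fin 2) (Fin 2) ℂ :=
  !![(α : ℂ), (β : ℂ); (β : ℂ), (δ : ℂ)]

theorem symMatrix_isSelfAdjoint (α β δ : ℝ) : IsSelfAdjoint (symMatrix α β δ) := by
  rw [IsSelfAdjoint, Matrix.star_eq_conjTranspose]
  ext i j
  fin_cases i <;> fin_cases j <;> simp [symMatrix]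

theorem cfc_symMatrix_entry (f : ℝ → ℝ) {α β δ x y : ℝ} (hxy : x ≠ y) (hadd : x + y = α + δ)
    (hmul : x * y = α * δ - β ^ 2) :
    (cfc f (symMatrix α β δ) 1 1).re = f y + (f x - f y) / (x - y) * (δ - y) := by
  have hadd' : (x : ℂ) + y = α + δ := by exact_mod_cast hadd
  have hmul' : (x : ℂ) * y = α * δ - β ^ 2 := by exact_mod_cast hmul
  have hM : (symMatrix α β δ - algebraMap ℝ _ x) * (symMatrix α β δ - algebraMap ℝ _ y) = 0 := by
    ext i j
    fin_cases i <;> fin_cases j <;>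
      simp [symMatrix, Matrix.mul_apply, Fin.sum_univ_two, Matrix.algebraMap_matrix_apply]
    · linear_combination hmul' - α * hadd'
    · linear_combination - β * hadd'
    · linear_combination - β * hadd'
    · linear_combination hmul' - δ * hadd'
  rw [cfc_eq_of_mul_eq_zero f (symMatrix_isSelfAdjoint α β δ) hxy hM]
  simp only [symMatrix, Matrix.add_apply, Matrix.smul_apply, Matrix.sub_apply,
    Matrix.algebraMap_matrix_apply, if_true, Complex.coe_algebraMap, Matrix.cons_val_one,
    Matrix.of_apply, Matrix.cons_val_fin_one, Complex.add_re, Complex.real_smul,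
    Complex.re_ofReal_mul, Complex.sub_re, Complex.ofReal_re]

theorem exists_eigenvalues {α β δ : ℝ} (hα : 0 < α) (hδ : 0 < δ) (hne : α ≠ δ)
    (h : β ^ 2 < α * δ) :
    ∃ x y : ℝ, 0 < y ∧ y < x ∧ y ≤ min α δ ∧ max α δ ≤ x ∧ x + y = α + δ ∧
      x * y = α * δ - β ^ 2 := by
  set D := Real.sqrt ((α - δ) ^ 2 + 4 * β ^ 2) with hD
  have hpos : 0 < (α - δ) ^ 2 := by
    have := sub_ne_zero.mpr hne
    positivity
  have hD2 : D ^ 2 = (α - δ) ^ 2 + 4 * β ^ 2 := Real.sq_sqrt (by positivity)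
  have hD0 : 0 < D := Real.sqrt_pos.mpr (by positivity)
  have h1 : |α - δ| ≤ D := abs_le_of_sq_le_sq (by nlinarith [sq_nonneg β]) hD0.le
  obtain ⟨h2, h3⟩ := abs_le.mp h1
  have h4 : D < α + δ := by nlinarith
  refine ⟨(α + δ + D) / 2, (α + δ - D) / 2, by linarith, by linarith, le_min (by linarith)
    (by linarith), max_le (by linarith) (by linarith), by ring, by nlinarith⟩

/-- The diagonal entry of `f` of a symmetric `2 × 2` matrix whose other diagonal entry is larger,
as an average of the values of `f` at the eigenvalues. -/
theorem exists_entry_of_gt {α β δ : ℝ} (hδ : 0 < δ) (hlt : δ < α) (h : β ^ 2 < α * δ) :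
    ∃ x y w : ℝ, 0 < y ∧ y ≤ δ ∧ α ≤ x ∧ x ≤ α + δ ∧ w ≤ 1 ∧ β ^ 2 / x ^ 2 ≤ w ∧
      w ≤ β ^ 2 / (α - δ) ^ 2 ∧
      ∀ f : ℝ → ℝ, (cfc f (symMatrix α β δ) 1 1).re = w * f x + (1 - w) * f y := by
  obtain ⟨x, y, hy, hyx, hmin, hmax, hadd, hmul⟩ :=
    exists_eigenvalues (hδ.trans hlt) hδ hlt.ne' h
  have h1 := hmin.trans (min_le_right _ _)
  have h2 := (le_max_left _ _).trans hmax
  -- The characteristic equation at `y`; it rewrites the weight of `f x` as `β² / ((α - y)(x - y))`,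
  -- whose denominator lies between `(α - δ)²` and `x²`.
  have hβ : β ^ 2 = (δ - y) * (α - y) := by
    have : x = α + δ - y := by linarith
    subst this
    linarith
  have hw : (δ - y) / (x - y) = β ^ 2 / ((α - y) * (x - y)) := by
    rw [hβ, mul_comm (δ - y), mul_div_mul_left _ _ (by linarith : α - y ≠ 0)]
  refine ⟨x, y, (δ - y) / (x - y), hy, h1, h2, by linarith, ?_, ?_, ?_, fun f => ?_⟩
  · rw [div_le_one (by linarith)]; linarith
  · rw [hw]
    refine div_le_div_of_nonneg_left (sq_nonneg _) (mul_pos (by linarith) (by linarith)) ?_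
    nlinarith
  · rw [hw]
    refine div_le_div_of_nonneg_left (sq_nonneg _) (pow_pos (by linarith) 2) ?_
    nlinarith
  · rw [cfc_symMatrix_entry f hyx.ne' hadd hmul]
    ring

/-- The counterpart with the other diagonal entry smaller, used for negative exponents. There the
small eigenvalue `y` dominates, and an upper bound for `y ^ (1 / r)` requires a lower bound for `y`.
-/
theorem exists_entry_of_lt {α β δ : ℝ} (hα : 0 < α) (hlt : α < δ) (h : β ^ 2 < α * δ) :
    ∃ x y w : ℝ, 0 < y ∧ y ≤ α ∧ α - β ^ 2 / (δ - α) ≤ y ∧ δ ≤ x ∧ x ≤ α + δ ∧ w ≤ 1 ∧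
      β ^ 2 / (α + δ) ^ 2 ≤ w ∧ w ≤ β ^ 2 / (δ - α) ^ 2 ∧
      ∀ f : ℝ → ℝ, (cfc f (symMatrix α β δ) 1 1).re = w * f y + (1 - w) * f x := by
  obtain ⟨x, y, hy, hyx, hmin, hmax, hadd, hmul⟩ :=
    exists_eigenvalues hα (hα.trans hlt) hlt.ne h
  have h1 := hmin.trans (min_le_left _ _)
  have h2 := (le_max_right _ _).trans hmax
  have hβ : β ^ 2 = (x - δ) * (x - α) := by
    have : y = α + δ - x := by linarith
    subst this
    linarith
  have hw : (x - δ) / (x - y) = β ^ 2 / ((x - α) * (x - y)) := by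
    rw [hβ, mul_comm (x - δ), mul_div_mul_left _ _ (by linarith : x - α ≠ 0)]
  refine ⟨x, y, (x - δ) / (x - y), hy, h1, ?_, h2, by linarith, ?_, ?_, ?_, fun f => ?_⟩
  · have : x - δ ≤ β ^ 2 / (δ - α) := by
      rw [le_div_iff₀ (by linarith), hβ]
      nlinarith
    linarith
  · rw [div_le_one (by linarith)]; linarith
  · rw [hw]
    refine div_le_div_of_nonneg_left (sq_nonneg _) (mul_pos (by linarith) (by linarith)) ?_
    nlinarith
  · rw [hw]
    refine div_le_div_of_nonneg_left (sq_nonneg _) (pow_pos (by linarith) 2) ?_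
    nlinarith
  · rw [cfc_symMatrix_entry f hyx.ne' hadd hmul]
    have : x - y ≠ 0 := by linarith
    field_simp
    ring_nf

/-! ### The family of isometries and the tested entry -/

/-- An isometry from `ℂ²` to `ℂ³`. -/
noncomputable def isometryMatrix (s : ℝ) : Matrix (Fin 3) (Fin 2) ℂ :=
  !![(√s / √2 : ℂ), (1 / √2 : ℂ); (-(√s / √2) : ℂ), (1 / √2 : ℂ); (√(1 - s) : ℂ), 0]

theorem conjTranspose_mul_diagonal_mul_isometryMatrix {s : ℝ} (h0 : 0 ≤ s) (h1 : s ≤ 1)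
    (d : Fin 3 → ℝ) :
    (isometryMatrix s).conjTranspose * Matrix.diagonal (fun i => (d i : ℂ)) * isometryMatrix s
      = symMatrix (s * ((d 0 + d 1) / 2) + (1 - s) * d 2) (√s * ((d 0 - d 1) / 2))
          ((d 0 + d 1) / 2) := by
  have hs : (√s : ℂ) ^ 2 = s := by exact_mod_cast Real.sq_sqrt h0
  have ht : (√(1 - s) : ℂ) ^ 2 = 1 - s := by exact_mod_cast Real.sq_sqrt (sub_nonneg.mpr h1)
  have h2 : (√2 : ℂ) ^ 2 = 2 := by exact_mod_cast Real.sq_sqrt (zero_le_two (α := ℝ))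
  have h2' : (√2 : ℂ)⁻¹ ^ 2 = 1 / 2 := by rw [inv_pow, h2, one_div]
  ext i j
  fin_cases i <;> fin_cases j <;>
    simp [isometryMatrix, symMatrix, Matrix.mul_apply, Fin.sum_univ_succ, Matrix.diagonal, div_eq_mul_inv]
  · linear_combination (s * (d 0 + d 1) : ℂ) * h2' + d 2 * ht + ((√2 : ℂ)⁻¹ ^ 2 * (d 0 + d 1) : ℂ) * hs
  · linear_combination (√s * (d 0 - d 1) : ℂ) * h2'
  · linear_combination (√s * (d 0 - d 1) : ℂ) * h2'
  · linear_combination ((d 0 + d 1) : ℂ) * h2'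

theorem isometryMatrix_isometry {s : ℝ} (h0 : 0 ≤ s) (h1 : s ≤ 1) :
    (isometryMatrix s).conjTranspose * isometryMatrix s = 1 := by
  have := conjTranspose_mul_diagonal_mul_isometryMatrix h0 h1 (fun _ => 1)
  simp only [Complex.ofReal_one, Matrix.diagonal_one, Matrix.mul_one] at this
  rw [this]
  ext i j
  fin_cases i <;> fin_cases j <;> simp [symMatrix]

theorem diagonal_ofReal_posDef {n : ℕ} {d : Fin n → ℝ} (hd : ∀ i, 0 < d i) :
    (Matrix.diagonal (fun i => (d i : ℂ))).PosDef :=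
  Matrix.PosDef.diagonal fun i => Complex.zero_lt_real.mpr (hd i)

theorem diagonal_ofReal_rpow {n : ℕ} {d : Fin n → ℝ} (hd : ∀ i, 0 < d i) (p : ℝ) :
    (Matrix.diagonal (fun i => (d i : ℂ))) ^ p
      = Matrix.diagonal (fun i => ((d i ^ p : ℝ) : ℂ)) := by
  rw [CFC.rpow_eq_cfc_real (diagonal_ofReal_posDef hd).posSemidef.nonneg,
    cfc_diagonal_ofReal (fun x => x ^ p) d]

/-- The lower right entry of the power mean of a diagonal matrix under the compression by
`isometryMatrix s`. -/
noncomputable def meanEntry (s : ℝ) (d : Fin 3 → ℝ) (p : ℝ) : ℝ :=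
  (powerMean (compression (isometryMatrix s)) p (Matrix.diagonal (fun i => (d i : ℂ))) 1 1).re

theorem meanEntry_of_ne_zero {s : ℝ} (h0 : 0 ≤ s) (h1 : s ≤ 1) {d : Fin 3 → ℝ}
    (hd : ∀ i, 0 < d i) {p : ℝ} (hp : p ≠ 0) :
    meanEntry s d p = (cfc (fun x : ℝ => x ^ (1 / p))
      (symMatrix (s * ((d 0 ^ p + d 1 ^ p) / 2) + (1 - s) * d 2 ^ p)
        (√s * ((d 0 ^ p - d 1 ^ p) / 2)) ((d 0 ^ p + d 1 ^ p) / 2)) 1 1).re := by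
  have hpos := (diagonal_ofReal_posDef (fun i => Real.rpow_pos_of_pos (hd i) p)).posSemidef.conjTranspose_mul_mul_same (isometryMatrix s)
  rw [conjTranspose_mul_diagonal_mul_isometryMatrix h0 h1] at hpos
  rw [meanEntry, powerMean, if_neg hp, diagonal_ofReal_rpow hd, compression_apply,
    conjTranspose_mul_diagonal_mul_isometryMatrix h0 h1, CFC.rpow_eq_cfc_real hpos.nonneg]

theorem meanEntry_zero {s : ℝ} (h0 : 0 ≤ s) (h1 : s ≤ 1) {d : Fin 3 → ℝ} :
    meanEntry s d 0 = (cfc Real.exp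
      (symMatrix (s * ((Real.log (d 0) + Real.log (d 1)) / 2) + (1 - s) * Real.log (d 2))
        (√s * ((Real.log (d 0) - Real.log (d 1)) / 2))
        ((Real.log (d 0) + Real.log (d 1)) / 2)) 1 1).re := by
  rw [meanEntry, powerMean, if_pos rfl, CFC.log, cfc_diagonal_ofReal, compression_apply,
    conjTranspose_mul_diagonal_mul_isometryMatrix h0 h1,
    CFC.real_exp_eq_normedSpace_exp (symMatrix_isSelfAdjoint _ _ _)]

/-! ### The inequality and its symmetry under inversion -/

/-- The inequality `Φ(A^p)^{1/p} ≤ Φ(A^q)^{1/q}` for all unital completely positive `Φ` and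
positive definite `A`. -/
def PowerMeanLE (p q : ℝ) : Prop :=
  ∀ Φ : Matrix (Fin 3) (Fin 3) ℂ →CP Matrix (Fin 2) (Fin 2) ℂ, Φ 1 = 1 →
    ∀ A : Matrix (Fin 3) (Fin 3) ℂ, A.PosDef → powerMean Φ p A ≤ powerMean Φ q A

theorem PowerMeanLE.meanEntry_le {p q : ℝ} (h : PowerMeanLE p q) {s : ℝ} (h0 : 0 ≤ s)
    (h1 : s ≤ 1) {d : Fin 3 → ℝ} (hd : ∀ i, 0 < d i) : meanEntry s d p ≤ meanEntry s d q :=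
  diag_re_le (h _ (compression_one _ (isometryMatrix_isometry h0 h1)) _
    (diagonal_ofReal_posDef hd)) 1

theorem exp_isStrictlyPositive {A : Type*} [CStarAlgebra A] [PartialOrder A] [StarOrderedRing A]
    {a : A} (ha : IsSelfAdjoint a) : IsStrictlyPositive (NormedSpace.exp a) :=
  let : NormedAlgebra ℚ A := .restrictScalars ℚ ℂ A
  IsStrictlyPositive.iff_of_unital.mpr ⟨ha.exp_nonneg, NormedSpace.isUnit_exp a⟩

theorem exp_neg_eq_rpow_neg_one {A : Type*} [CStarAlgebra A] [PartialOrder A] [StarOrderedRing A]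
    {a : A} (ha : IsSelfAdjoint a) : NormedSpace.exp (-a) = (NormedSpace.exp a) ^ (-1 : ℝ) := by
  let : NormedAlgebra ℚ A := .restrictScalars ℚ ℂ A
  rw [← CFC.inverse_eq_rpow_neg_one (exp_isStrictlyPositive ha), Ring.inverse_exp]

theorem log_rpow_neg_one {A : Type*} [CStarAlgebra A] [PartialOrder A] [StarOrderedRing A]
    {a : A} (ha : IsStrictlyPositive a) : CFC.log (a ^ (-1 : ℝ)) = -CFC.log a := by
  conv_lhs => rw [← CFC.exp_log a ha, ← exp_neg_eq_rpow_neg_one .log]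
  exact CFC.log_exp _ (IsSelfAdjoint.log.neg)

theorem map_isStrictlyPositive {n m : ℕ} [NeZero n]
    (Φ : Matrix (Fin n) (Fin n) ℂ →CP Matrix (Fin m) (Fin m) ℂ)
    (hΦ : Φ 1 = 1) {A : Matrix (Fin n) (Fin n) ℂ} (hA : IsStrictlyPositive A) :
    IsStrictlyPositive (Φ A) := by
  obtain ⟨r, hr, hrA⟩ := (CFC.exists_pos_algebraMap_le_iff hA.isSelfAdjoint).mpr
    (fun x hx => hA.spectrum_pos hx)
  have h1 : Φ (algebraMap ℝ _ r) ≤ Φ A := OrderHomClass.mono Φ hrA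
  have h2 : Φ (algebraMap ℝ _ r) = algebraMap ℝ _ r := by
    rw [Algebra.algebraMap_eq_smul_one, Algebra.algebraMap_eq_smul_one]
    have := map_smul Φ (r : ℂ) (1 : Matrix (Fin n) (Fin n) ℂ)
    rw [hΦ] at this
    simpa using this
  rw [h2] at h1
  exact IsStrictlyPositive.of_le (isStrictlyPositive_algebraMap hr) h1

theorem completelyPositive_map_isSelfAdjoint {n m : ℕ}
    (Φ : Matrix (Fin n) (Fin n) ℂ →CP Matrix (Fin m) (Fin m) ℂ)
    {A : Matrix (Fin n) (Fin n) ℂ} (hA : IsSelfAdjoint A) : IsSelfAdjoint (Φ A) := by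
  rw [← CFC.posPart_sub_negPart A hA, map_sub]
  exact (map_nonneg Φ (CFC.posPart_nonneg A)).isSelfAdjoint.sub
    (map_nonneg Φ (CFC.negPart_nonneg A)).isSelfAdjoint

theorem powerMean_isStrictlyPositive {n m : ℕ} [NeZero n]
    (Φ : Matrix (Fin n) (Fin n) ℂ →CP Matrix (Fin m) (Fin m) ℂ)
    (hΦ : Φ 1 = 1) {A : Matrix (Fin n) (Fin n) ℂ} (hA : IsStrictlyPositive A) (p : ℝ) :
    IsStrictlyPositive (powerMean Φ p A) := by
  rw [powerMean]
  split_ifs with hp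
  · exact exp_isStrictlyPositive (completelyPositive_map_isSelfAdjoint Φ .log)
  · exact IsStrictlyPositive.rpow _ _
      (map_isStrictlyPositive Φ hΦ (IsStrictlyPositive.rpow A p hA))

theorem powerMean_rpow_neg_one {n m : ℕ} [NeZero n]
    (Φ : Matrix (Fin n) (Fin n) ℂ →CP Matrix (Fin m) (Fin m) ℂ)
    (hΦ : Φ 1 = 1) {A : Matrix (Fin n) (Fin n) ℂ} (hA : IsStrictlyPositive A) (p : ℝ) :
    powerMean Φ p (A ^ (-1 : ℝ)) = (powerMean Φ (-p) A) ^ (-1 : ℝ) := by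
  by_cases hp : p = 0
  · subst hp
    simp only [powerMean, neg_zero, if_true]
    rw [log_rpow_neg_one hA, map_neg, exp_neg_eq_rpow_neg_one (completelyPositive_map_isSelfAdjoint Φ .log)]
  · have hp' : -p ≠ 0 := neg_ne_zero.mpr hp
    have hS := map_isStrictlyPositive Φ hΦ (IsStrictlyPositive.rpow A (-p) hA)
    simp only [powerMean, if_neg hp, if_neg hp']
    rw [CFC.rpow_rpow A _ _ (by norm_num) hA, CFC.rpow_rpow (Φ _) _ _ (by simpa) (by simpa using hS)]
    simp

/-- Apply the hypothesis to `A⁻¹`, whose mean of exponent `r` is the inverse of the mean of `A` of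
exponent `-r`; inversion is antitone. -/
theorem PowerMeanLE.neg {p q : ℝ} (h : PowerMeanLE p q) : PowerMeanLE (-q) (-p) := by
  intro Φ hΦ A hA
  have hA' := hA.isStrictlyPositive
  have hB := IsStrictlyPositive.rpow A (-1) hA'
  have h2 := CStarAlgebra.rpow_neg_one_le_rpow_neg_one (h Φ hΦ _ (Matrix.isStrictlyPositive_iff_posDef.mp hB))
    (powerMean_isStrictlyPositive Φ hΦ hB _)
  have hinv : ∀ r, ((powerMean Φ r A) ^ (-1 : ℝ)) ^ (-1 : ℝ) = powerMean Φ r A := fun r => by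
    have hr := powerMean_isStrictlyPositive Φ hΦ hA' r
    rw [CFC.rpow_rpow _ _ _ (by norm_num) hr, neg_one_mul, neg_neg, CFC.rpow_one _ hr.nonneg]
  rwa [powerMean_rpow_neg_one Φ hΦ hA', powerMean_rpow_neg_one Φ hΦ hA', hinv, hinv] at h2

/-! ### Test matrices, and necessity of `p ≤ q` from scalar means -/

theorem cfc_symMatrix_zero_entry (f : ℝ → ℝ) (α δ : ℝ) :
    (cfc f (symMatrix α 0 δ) 1 1).re = f δ := by
  have : symMatrix α 0 δ = Matrix.diagonal (fun i => ((![α, δ] i : ℝ) : ℂ)) := by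
    ext i j
    fin_cases i <;> fin_cases j <;> simp [symMatrix]
  rw [this, cfc_diagonal_ofReal]
  simp

/-- Positive eigenvalues `2, 1, c` for a diagonal test matrix. -/
noncomputable def testDiag (c : ℝ) : Fin 3 → ℝ := ![2, 1, c]

theorem testDiag_pos {c : ℝ} (hc : 0 < c) (i : Fin 3) : 0 < testDiag c i := by
  fin_cases i <;> simp [testDiag, hc]

theorem meanEntry_testDiag {s c : ℝ} (h0 : 0 ≤ s) (h1 : s ≤ 1) (hc : 0 < c) {p : ℝ}
    (hp : p ≠ 0) :
    meanEntry s (testDiag c) p = (cfc (fun x : ℝ => x ^ (1 / p))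
      (symMatrix (s * ((2 ^ p + 1) / 2) + (1 - s) * c ^ p)
        (√s * ((2 ^ p - 1) / 2)) ((2 ^ p + 1) / 2)) 1 1).re := by
  rw [meanEntry_of_ne_zero h0 h1 (testDiag_pos hc) hp]
  simp [testDiag]

theorem meanEntry_testDiag_zero {s : ℝ} (c : ℝ) (h0 : 0 ≤ s) (h1 : s ≤ 1) :
    meanEntry s (testDiag c) 0 = (cfc Real.exp
      (symMatrix (s * (Real.log 2 / 2) + (1 - s) * Real.log c)
        (√s * (Real.log 2 / 2)) (Real.log 2 / 2)) 1 1).re := by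
  rw [meanEntry_zero h0 h1]
  simp [testDiag]

/-- At `s = 0` the off-diagonal entry vanishes, leaving the scalar power mean of `2` and `1`. -/
theorem meanEntry_scalar {p : ℝ} (hp : p ≠ 0) :
    meanEntry 0 (testDiag 1) p = ((2 ^ p + 1) / 2) ^ (1 / p) := by
  rw [meanEntry_testDiag le_rfl zero_le_one one_pos hp]
  simp [cfc_symMatrix_zero_entry]

theorem meanEntry_scalar_zero : meanEntry 0 (testDiag 1) 0 = Real.exp (Real.log 2 / 2) := by
  rw [meanEntry_testDiag_zero 1 le_rfl zero_le_one]
  simp [cfc_symMatrix_zero_entry]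

/-- Strict AM–GM for `2^p` and `1`: with `t = √2 ^ p ≠ 1`, it is `(t - 1)² > 0`. -/
theorem two_rpow_half_lt {p : ℝ} (hp : p ≠ 0) : Real.exp (Real.log 2 / 2) ^ p < (2 ^ p + 1) / 2 := by
  have h1 : (2 : ℝ) ^ p = (Real.exp (Real.log 2 / 2) ^ p) ^ 2 := by
    rw [← Real.exp_mul, ← Real.exp_nat_mul, Real.rpow_def_of_pos two_pos]
    congr 1
    push_cast
    ring
  have h2 : Real.exp (Real.log 2 / 2) ^ p ≠ 1 := by
    rw [← Real.exp_mul, Ne, Real.exp_eq_one_iff]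
    have := (Real.log_pos one_lt_two).ne'
    positivity
  rw [h1]
  have := sq_pos_of_ne_zero (sub_ne_zero.mpr h2)
  nlinarith

theorem meanEntry_scalar_zero_lt {p : ℝ} (hp : 0 < p) :
    meanEntry 0 (testDiag 1) 0 < meanEntry 0 (testDiag 1) p := by
  rw [meanEntry_scalar hp.ne', meanEntry_scalar_zero]
  have := Real.rpow_lt_rpow (by positivity) (two_rpow_half_lt hp.ne') (one_div_pos.mpr hp)
  rwa [← Real.rpow_mul (by positivity), mul_one_div_cancel hp.ne', Real.rpow_one] at this

theorem meanEntry_scalar_lt_zero {p : ℝ} (hp : p < 0) :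
    meanEntry 0 (testDiag 1) p < meanEntry 0 (testDiag 1) 0 := by
  rw [meanEntry_scalar hp.ne, meanEntry_scalar_zero]
  have := Real.rpow_lt_rpow_of_neg (by positivity) (two_rpow_half_lt hp.ne) (one_div_neg.mpr hp)
  rwa [← Real.rpow_mul (by positivity), mul_one_div_cancel hp.ne, Real.rpow_one] at this

theorem meanEntry_scalar_lt {p q : ℝ} (hq : 0 < q) (hqp : q < p) :
    meanEntry 0 (testDiag 1) q < meanEntry 0 (testDiag 1) p := by
  have hp := hq.trans hqp
  rw [meanEntry_scalar hp.ne', meanEntry_scalar hq.ne']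
  have h1 := (strictConvexOn_rpow ((one_lt_div hq).mpr hqp)).2
    (Set.mem_Ici.mpr (by positivity) : (2 : ℝ) ^ q ∈ Set.Ici 0)
    (Set.mem_Ici.mpr zero_le_one : (1 : ℝ) ∈ Set.Ici 0)
    (Real.one_lt_rpow one_lt_two hq).ne' (half_pos one_pos) (half_pos one_pos) (add_halves 1)
  simp only [smul_eq_mul, Real.one_rpow, ← Real.rpow_mul zero_le_two, mul_div_cancel₀ p hq.ne'] at h1
  have h2 := Real.rpow_lt_rpow (by positivity) h1 (one_div_pos.mpr hp)
  rw [← Real.rpow_mul (by positivity)] at h2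
  convert h2 using 2
  · ring
  · field_simp
  · ring

theorem PowerMeanLE.le {p q : ℝ} (h : PowerMeanLE p q) : p ≤ q := by
  have key : ∀ {p q : ℝ}, PowerMeanLE p q → 0 ≤ q → p ≤ q := by
    intro p q h hq
    by_contra! hlt
    refine absurd (h.meanEntry_le le_rfl zero_le_one (testDiag_pos one_pos)) (not_le.mpr ?_)
    rcases hq.eq_or_lt with rfl | hq
    · exact meanEntry_scalar_zero_lt hlt
    · exact meanEntry_scalar_lt hq hlt
  rcases le_total 0 q with hq | hq
  · exact key h hq
  rcases le_total 0 p with hp | hp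
  · by_contra! hlt
    refine absurd (h.meanEntry_le le_rfl zero_le_one (testDiag_pos one_pos)) (not_le.mpr ?_)
    rcases hp.eq_or_lt with rfl | hp
    · exact meanEntry_scalar_lt_zero hlt
    · rcases hq.eq_or_lt with rfl | hq
      · exact meanEntry_scalar_zero_lt hp
      · exact (meanEntry_scalar_lt_zero hq).trans (meanEntry_scalar_zero_lt hp)
  · have := key h.neg (neg_nonneg.mpr hp)
    linarith

/-! ### Growth of the entry as `c → ∞`, and failure for `q > 0` -/

open Filter Topology in
theorem false_of_eventually_rpow_le {k K x y : ℝ} (hk : 0 < k) (hx : 0 < x) (hyx : y < x)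
    (h : ∀ᶠ c : ℝ in atTop, k * c ^ x ≤ K * (c ^ y + 1)) : False := by
  have hz : 0 < x - max y 0 := sub_pos.mpr (max_lt hyx hx)
  have h1 := (tendsto_rpow_atTop hz).eventually_gt_atTop (2 * |K| / k)
  obtain ⟨c, ⟨hc, hc1⟩, hc2⟩ := ((h.and h1).and (eventually_ge_atTop 1)).exists
  have hc0 : 0 < c := by linarith
  have h2 : c ^ y ≤ c ^ max y 0 := Real.rpow_le_rpow_of_exponent_le hc2 (le_max_left _ _)
  have h3 : 1 ≤ c ^ max y 0 := Real.one_le_rpow hc2 (le_max_right _ _)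
  have h4 : 0 < c ^ max y 0 := by positivity
  rw [Real.rpow_sub hc0, div_lt_div_iff₀ hk h4] at hc1
  have h5 : K * (c ^ y + 1) ≤ |K| * (2 * c ^ max y 0) :=
    mul_le_mul (le_abs_self K) (by linarith) (by positivity) (abs_nonneg K)
  nlinarith

/-- Positivity of the determinant of the compressed matrix, as the eigenvalue lemmas require. -/
theorem sqrt_mul_sq_lt {s b e t : ℝ} (h0 : 0 ≤ s) (h1 : s ≤ 1) (he : 0 < e) (ht : 0 < t)
    (hb : b ^ 2 < e ^ 2) : (√s * b) ^ 2 < (s * e + (1 - s) * t) * e := by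
  rw [mul_pow, Real.sq_sqrt h0]
  rcases h0.eq_or_lt with rfl | h0
  · have := mul_pos ht he
    nlinarith
  · have h2 : 0 ≤ (1 - s) * t * e := by
      have : 0 ≤ 1 - s := by linarith
      positivity
    nlinarith

theorem half_sub_sq_lt (p : ℝ) : (((2 : ℝ) ^ p - 1) / 2) ^ 2 < ((2 ^ p + 1) / 2) ^ 2 := by
  have : (0 : ℝ) < 2 ^ p := by positivity
  nlinarith

theorem half_sub_sq_pos {p : ℝ} (hp : p ≠ 0) : 0 < (((2 : ℝ) ^ p - 1) / 2) ^ 2 := by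
  have : (2 : ℝ) ^ p ≠ 1 := by
    intro h
    have h1 := congrArg Real.log h
    rw [Real.log_rpow two_pos, Real.log_one] at h1
    exact mul_ne_zero hp (Real.log_pos one_lt_two).ne' h1
  have : (2 : ℝ) ^ p - 1 ≠ 0 := sub_ne_zero.mpr this
  positivity

open Filter Topology in
-- The large eigenvalue has order `c^q` and weight `O(s / c^(2q))`, so it contributes `O(s
-- c^(1-2q))`; the other stays bounded. Uniformity in `s` allows `s` to depend on `c`.
theorem meanEntry_le_of_pos {q : ℝ} (hq : 0 < q) :
    ∃ K : ℝ, 0 ≤ K ∧ ∀ᶠ c : ℝ in atTop, ∀ s, 0 ≤ s → s ≤ 1 / 2 →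
      meanEntry s (testDiag c) q ≤ K * (s * c ^ (1 - 2 * q) + 1) := by
  set e : ℝ := (2 ^ q + 1) / 2 with he
  set b : ℝ := (2 ^ q - 1) / 2 with hb
  have he0 : 0 < e := by positivity
  refine ⟨16 * b ^ 2 * 2 ^ (1 / q) + e ^ (1 / q), by positivity, ?_⟩
  filter_upwards [(tendsto_rpow_atTop hq).eventually_ge_atTop (4 * e), eventually_gt_atTop 0]
    with c hc hc0 s h0 h1
  have hcq : 0 < c ^ q := by positivity
  rw [meanEntry_testDiag h0 (by linarith) hc0 hq.ne', ← he, ← hb]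
  have hα : c ^ q / 2 ≤ s * e + (1 - s) * c ^ q := by nlinarith
  obtain ⟨x, y, w, hy0, hy, hx, hx', hw1, hw, hw', hf⟩ := exists_entry_of_gt he0
    (show e < s * e + (1 - s) * c ^ q by linarith)
    (sqrt_mul_sq_lt h0 (by linarith) he0 hcq (half_sub_sq_lt q))
  rw [hf]
  have hw0 : 0 ≤ w := le_trans (by positivity) hw
  have hx2 : x ≤ 2 * c ^ q := by nlinarith
  have hx0 : 0 < x := by linarith
  have h2 : x ^ (1 / q) ≤ 2 ^ (1 / q) * c := by
    refine (Real.rpow_le_rpow hx0.le hx2 (by positivity)).trans (le_of_eq ?_)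
    rw [Real.mul_rpow zero_le_two hcq.le, ← Real.rpow_mul hc0.le, mul_one_div_cancel hq.ne',
      Real.rpow_one]
  have h3 : y ^ (1 / q) ≤ e ^ (1 / q) := Real.rpow_le_rpow hy0.le hy (by positivity)
  have h4 : w ≤ 16 * b ^ 2 * s / (c ^ q) ^ 2 := by
    refine hw'.trans ?_
    rw [mul_pow, Real.sq_sqrt h0]
    calc s * b ^ 2 / (s * e + (1 - s) * c ^ q - e) ^ 2 ≤ s * b ^ 2 / (c ^ q / 4) ^ 2 := by
          refine div_le_div_of_nonneg_left (by positivity) (by positivity) ?_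
          exact pow_le_pow_left₀ (by positivity) (by linarith) 2
      _ = _ := by field_simp; ring
  have h5 : c ^ (1 - 2 * q) = c / (c ^ q) ^ 2 := by
    rw [Real.rpow_sub hc0, Real.rpow_one, mul_comm, Real.rpow_mul hc0.le, Real.rpow_two]
  have h6 : w * x ^ (1 / q) ≤ 16 * b ^ 2 * 2 ^ (1 / q) * (s * c ^ (1 - 2 * q)) := by
    refine (mul_le_mul h4 h2 (by positivity) (by positivity)).trans (le_of_eq ?_)
    rw [h5]
    ring
  have h7 : (1 - w) * y ^ (1 / q) ≤ e ^ (1 / q) :=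
    (mul_le_of_le_one_left (by positivity) (by linarith)).trans h3
  have h8 : 0 ≤ 16 * b ^ 2 * (2 : ℝ) ^ (1 / q) := by positivity
  have h9 : 0 ≤ e ^ (1 / q) * (s * c ^ (1 - 2 * q)) := by positivity
  linarith

open Filter Topology in
theorem le_meanEntry_of_pos_of_lt_half {p : ℝ} (hp : 0 < p) (hp' : p < 1 / 2) :
    ∃ k : ℝ, 0 < k ∧ ∀ᶠ c : ℝ in atTop,
      k * c ^ (1 - 2 * p) ≤ meanEntry (1 / 2) (testDiag c) p := by
  set e : ℝ := (2 ^ p + 1) / 2 with he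
  set b : ℝ := (2 ^ p - 1) / 2 with hb
  have he0 : 0 < e := by positivity
  have hb2 : 0 < b ^ 2 := half_sub_sq_pos hp.ne'
  -- The dominant term is at least a constant times `x^(1/p) / x²`, which increases with `x` because
  -- `p < 1/2`; hence a lower bound for `x` suffices.
  have hr : 0 < 1 / p - 2 := by
    rw [sub_pos, lt_div_iff₀ hp]
    linarith
  refine ⟨1 / 2 * b ^ 2 * (1 / 2) ^ (1 / p - 2), by positivity, ?_⟩
  filter_upwards [(tendsto_rpow_atTop hp).eventually_ge_atTop (4 * e), eventually_gt_atTop 0]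
    with c hc hc0
  have hcp : 0 < c ^ p := by positivity
  rw [meanEntry_testDiag (by norm_num) (by norm_num) hc0 hp.ne', ← he, ← hb]
  obtain ⟨x, y, w, hy0, hy, hx, hx', hw1, hw, hw', hf⟩ := exists_entry_of_gt he0
    (show e < 1 / 2 * e + (1 - 1 / 2) * c ^ p by linarith)
    (sqrt_mul_sq_lt (s := 1 / 2) (by norm_num) (by norm_num) he0 hcp (half_sub_sq_lt p))
  rw [hf]
  have hx0 : 0 < x := by linarith
  have h1 : (1 / 2 * c ^ p) ^ (1 / p - 2) ≤ x ^ (1 / p - 2) :=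
    Real.rpow_le_rpow (by positivity) (by linarith) hr.le
  have h2 : (1 / 2 * c ^ p) ^ (1 / p - 2) = (1 / 2) ^ (1 / p - 2) * c ^ (1 - 2 * p) := by
    rw [Real.mul_rpow (by norm_num) hcp.le, ← Real.rpow_mul hc0.le]
    congr 2
    field_simp
  have h3 : x ^ (1 / p - 2) = x ^ (1 / p) / x ^ 2 := by
    rw [Real.rpow_sub hx0, Real.rpow_two]
  have h4 : 0 ≤ (1 - w) * y ^ (1 / p) := mul_nonneg (by linarith) (by positivity)
  rw [mul_pow, Real.sq_sqrt (by norm_num)] at hw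
  have h5 : 1 / 2 * b ^ 2 / x ^ 2 * x ^ (1 / p) ≤ w * x ^ (1 / p) :=
    mul_le_mul_of_nonneg_right hw (by positivity)
  calc _ = 1 / 2 * b ^ 2 * (1 / 2 * c ^ p) ^ (1 / p - 2) := by rw [h2]; ring
    _ ≤ 1 / 2 * b ^ 2 * x ^ (1 / p - 2) := by gcongr
    _ = 1 / 2 * b ^ 2 / x ^ 2 * x ^ (1 / p) := by rw [h3]; ring
    _ ≤ _ := by linarith

open Filter Topology in
theorem le_meanEntry_zero {s : ℝ} (hs : 0 < s) (hs' : s < 1 / 2) :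
    ∃ k : ℝ, 0 < k ∧ ∀ᶠ c : ℝ in atTop,
      k * c ^ (1 - 2 * s) ≤ meanEntry s (testDiag c) 0 := by
  set l : ℝ := Real.log 2 / 2 with hl
  have hl0 : 0 < l := half_pos (Real.log_pos one_lt_two)
  refine ⟨s * l ^ 2 * (s ^ 2 / 2), by positivity, ?_⟩
  filter_upwards [eventually_gt_atTop 2] with c hc
  have hc0 : 0 < c := by linarith
  have hlog : l < Real.log c := by
    have := Real.log_lt_log two_pos hc
    linarith
  rw [meanEntry_testDiag_zero c hs.le (by linarith), ← hl]
  have hdet : (√s * l) ^ 2 < (s * l + (1 - s) * Real.log c) * l := by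
    rw [mul_pow, Real.sq_sqrt hs.le]
    have : 0 < (1 - s) * Real.log c * l :=
      mul_pos (mul_pos (by linarith) (by linarith)) hl0
    nlinarith
  obtain ⟨x, y, w, hy0, hy, hx, hx', hw1, hw, hw', hf⟩ := exists_entry_of_gt hl0
    (show l < s * l + (1 - s) * Real.log c by nlinarith) hdet
  rw [hf]
  have hx1 : (1 - s) * Real.log c ≤ x := by nlinarith
  have hx0 : 0 < x := lt_of_lt_of_le (mul_pos (by linarith) (by linarith)) hx1
  -- The weight is of order `1 / x²`. The factor `exp (s x)` of `exp x` absorbs it, and `exp ((1 -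
  -- s) x) ≥ c^((1-s)²) ≥ c^(1-2s)`.
  have h1 : s ^ 2 / 2 * x ^ 2 ≤ Real.exp (s * x) := by
    have := Real.quadratic_le_exp_of_nonneg (mul_pos hs hx0).le
    nlinarith [mul_pos hs hx0]
  have h2 : c ^ (1 - 2 * s) ≤ Real.exp ((1 - s) * x) := by
    rw [Real.rpow_def_of_pos hc0, Real.exp_le_exp]
    have : (1 - s) * ((1 - s) * Real.log c) ≤ (1 - s) * x :=
      mul_le_mul_of_nonneg_left hx1 (by linarith)
    nlinarith [mul_pos (mul_pos hs hs) (hl0.trans hlog)]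
  have h3 : Real.exp x = Real.exp (s * x) * Real.exp ((1 - s) * x) := by
    rw [← Real.exp_add]
    congr 1
    ring
  have h4 : 0 ≤ (1 - w) * Real.exp y := mul_nonneg (by linarith) (Real.exp_pos _).le
  rw [mul_pow, Real.sq_sqrt hs.le] at hw
  have h5 : s * l ^ 2 / x ^ 2 * Real.exp x ≤ w * Real.exp x :=
    mul_le_mul_of_nonneg_right hw (Real.exp_pos _).le
  have h6 : s ^ 2 / 2 * x ^ 2 * c ^ (1 - 2 * s) ≤ Real.exp x := by
    rw [h3]
    exact mul_le_mul h1 h2 (by positivity) (Real.exp_pos _).le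
  calc _ = s * l ^ 2 / x ^ 2 * (s ^ 2 / 2 * x ^ 2 * c ^ (1 - 2 * s)) := by field_simp
    _ ≤ s * l ^ 2 / x ^ 2 * Real.exp x := by gcongr
    _ ≤ _ := by linarith

open Filter Topology in
-- With `s = c^p` both terms of the small diagonal entry are `O(c^p)`. The small eigenvalue then
-- contributes at least order `c`, with weight at least of order `s = c^p`.
theorem le_meanEntry_of_neg {p : ℝ} (hp : p < 0) :
    ∃ k : ℝ, 0 < k ∧ ∀ᶠ c : ℝ in atTop,
      k * c ^ (p + 1) ≤ meanEntry (c ^ p) (testDiag c) p := by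
  set e : ℝ := (2 ^ p + 1) / 2 with he
  set b : ℝ := (2 ^ p - 1) / 2 with hb
  have he0 : 0 < e := by positivity
  have hb2 : 0 < b ^ 2 := half_sub_sq_pos hp.ne
  refine ⟨b ^ 2 / (2 * e) ^ 2 * (e + 1) ^ (1 / p), by positivity, ?_⟩
  have hlim : Tendsto (fun c : ℝ => c ^ p * (e + 1)) atTop (𝓝 (0 * (e + 1))) := by
    have := (tendsto_rpow_neg_atTop (neg_pos.mpr hp)).mul_const (e + 1)
    simpa using this
  rw [zero_mul] at hlim
  filter_upwards [hlim.eventually_lt_const he0, hlim.eventually_lt_const one_pos,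
    eventually_gt_atTop 0] with c hc hc1 hc0
  have hcp : 0 < c ^ p := by positivity
  have hs1 : c ^ p ≤ 1 := by nlinarith
  rw [meanEntry_testDiag hcp.le hs1 hc0 hp.ne, ← he, ← hb]
  have hα : c ^ p * e + (1 - c ^ p) * c ^ p ≤ c ^ p * (e + 1) := by nlinarith
  have hα0 : 0 < c ^ p * e + (1 - c ^ p) * c ^ p := by
    have : 0 ≤ (1 - c ^ p) * c ^ p := mul_nonneg (by linarith) hcp.le
    positivity
  obtain ⟨x, y, w, hy0, hy, hy', hx, hx', hw1, hw, hw', hf⟩ := exists_entry_of_lt hα0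
    (hα.trans_lt hc) (sqrt_mul_sq_lt hcp.le hs1 he0 hcp (half_sub_sq_lt p))
  rw [hf]
  have h1 : c * (e + 1) ^ (1 / p) ≤ y ^ (1 / p) := by
    refine le_trans (le_of_eq ?_) (Real.rpow_le_rpow_of_nonpos hy0 (hy.trans hα)
      (one_div_neg.mpr hp).le)
    rw [Real.mul_rpow hcp.le (by linarith), ← Real.rpow_mul hc0.le, mul_one_div_cancel hp.ne,
      Real.rpow_one]
  have h2 : c ^ p * b ^ 2 / (2 * e) ^ 2 ≤ w := by
    refine le_trans ?_ hw
    rw [mul_pow √(c ^ p), Real.sq_sqrt hcp.le]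
    refine div_le_div_of_nonneg_left (by positivity) (by positivity) ?_
    exact pow_le_pow_left₀ (by positivity) (by linarith) 2
  have hx0 : 0 < x := by linarith
  have h3 : 0 ≤ (1 - w) * x ^ (1 / p) := mul_nonneg (by linarith) (by positivity)
  calc _ = c ^ p * b ^ 2 / (2 * e) ^ 2 * (c * (e + 1) ^ (1 / p)) := by
        rw [Real.rpow_add hc0, Real.rpow_one]; ring
    _ ≤ w * y ^ (1 / p) := mul_le_mul h2 h1 (by positivity) (le_trans (by positivity) h2)
    _ ≤ _ := by linarith

open Filter Topology in
theorem not_powerMeanLE_of_pos {p q : ℝ} (hp : -1 < p) (hp' : p < 1 / 2) (hpq : p < q)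
    (hq : 0 < q) : ¬ PowerMeanLE p q := by
  intro h
  obtain ⟨K, hK, hU⟩ := meanEntry_le_of_pos hq
  rcases lt_trichotomy p 0 with hp0 | rfl | hp0
  · obtain ⟨k, hk, hL⟩ := le_meanEntry_of_neg hp0
    refine false_of_eventually_rpow_le (K := K) (y := p + 1 - 2 * q) hk (by linarith)
      (by linarith : _ < p + 1) ?_
    have hlim : Tendsto (fun c : ℝ => c ^ p) atTop (𝓝 0) := by
      simpa using tendsto_rpow_neg_atTop (neg_pos.mpr hp0)
    filter_upwards [hU, hL, eventually_gt_atTop 0, hlim.eventually_le_const one_half_pos]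
      with c h1 h2 hc0 hc
    refine h2.trans ((h.meanEntry_le (by positivity) (by linarith) (testDiag_pos hc0)).trans
      ((h1 _ (by positivity) hc).trans (le_of_eq ?_)))
    rw [← Real.rpow_add hc0, add_sub_assoc]
  -- Chosen so that `1 - 2s` exceeds both `1 - 2q` and `0`.
  · set s := min (q / 2) (1 / 4) with hs
    have hs0 : 0 < s := by positivity
    have hs1 : s ≤ 1 / 4 := min_le_right _ _
    have hs2 : s ≤ q / 2 := min_le_left _ _
    obtain ⟨k, hk, hL⟩ := le_meanEntry_zero hs0 (by linarith)
    refine false_of_eventually_rpow_le (K := K) (y := 1 - 2 * q) hk (by linarith)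
      (by linarith : _ < 1 - 2 * s) ?_
    filter_upwards [hU, hL, eventually_gt_atTop 0] with c h1 h2 hc0
    refine h2.trans ((h.meanEntry_le hs0.le (by linarith) (testDiag_pos hc0)).trans
      ((h1 _ hs0.le (by linarith)).trans ?_))
    have : 0 < c ^ (1 - 2 * q) := by positivity
    gcongr
    nlinarith
  · obtain ⟨k, hk, hL⟩ := le_meanEntry_of_pos_of_lt_half hp0 hp'
    refine false_of_eventually_rpow_le (K := K) (y := 1 - 2 * q) hk (by linarith)
      (by linarith : _ < 1 - 2 * p) ?_
    filter_upwards [hU, hL, eventually_gt_atTop 0] with c h1 h2 hc0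
    refine h2.trans ((h.meanEntry_le (by norm_num) (by norm_num) (testDiag_pos hc0)).trans
      ((h1 _ (by norm_num) (by norm_num)).trans ?_))
    have : 0 < c ^ (1 - 2 * q) := by positivity
    gcongr
    nlinarith

/-! ### Sharp asymptotics, and failure for `q < 0` -/

open Filter Topology in
theorem tendsto_smaller_entry (e : ℝ) {r ν : ℝ} (hr : r < 0) (hν : 0 < ν) :
    Tendsto (fun c : ℝ => c ^ (-ν) * e + (1 - c ^ (-ν)) * c ^ r) atTop (𝓝 0) := by
  have h1 := tendsto_rpow_neg_atTop hν
  have h2 : Tendsto (fun c : ℝ => c ^ r) atTop (𝓝 0) := by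
    simpa using tendsto_rpow_neg_atTop (neg_pos.mpr hr)
  simpa using (h1.mul_const e).add ((h1.const_sub 1).mul h2)

open Filter Topology in
-- Because `ν > -r`, the term `c^(-ν) e` is negligible against `c^r`.
theorem tendsto_smaller_entry_div (e : ℝ) {r ν : ℝ} (hν : 0 < ν) (hrν : -r < ν) :
    Tendsto (fun c : ℝ => (c ^ (-ν) * e + (1 - c ^ (-ν)) * c ^ r) / c ^ r) atTop (𝓝 1) := by
  have h1 := tendsto_rpow_neg_atTop hν
  have h2 := tendsto_rpow_neg_atTop (by linarith : 0 < ν + r)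
  have h3 := (h2.mul_const e).add (h1.const_sub 1)
  rw [zero_mul, zero_add, sub_zero] at h3
  refine h3.congr' ?_
  filter_upwards [eventually_gt_atTop 0] with c hc
  have : 0 < c ^ r := by positivity
  rw [neg_add, Real.rpow_add hc, Real.rpow_neg hc.le r]
  field_simp

open Filter Topology in
/-- For `-ν < r < 0`, a lower bound for the entry which is asymptotically sharp. -/
theorem eventually_le_meanEntry_div {r ν : ℝ} (hr : r < 0) (hν : 0 < ν) (hrν : -r < ν) :
    ∃ L : ℝ → ℝ, Tendsto L atTop (𝓝 (((2 ^ r - 1) / 2) ^ 2 / ((2 ^ r + 1) / 2) ^ 2)) ∧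
      ∀ᶠ c : ℝ in atTop, L c * c ^ (1 - ν) ≤ meanEntry (c ^ (-ν)) (testDiag c) r := by
  set e : ℝ := (2 ^ r + 1) / 2 with he
  set b : ℝ := (2 ^ r - 1) / 2 with hb
  have he0 : 0 < e := by positivity
  set α : ℝ → ℝ := fun c => c ^ (-ν) * e + (1 - c ^ (-ν)) * c ^ r with hα
  have hα1 : Tendsto α atTop (𝓝 0) := tendsto_smaller_entry e hr hν
  have hα2 : Tendsto (fun c => α c / c ^ r) atTop (𝓝 1) := tendsto_smaller_entry_div e hν hrν
  refine ⟨fun c => b ^ 2 / (α c + e) ^ 2 * (α c / c ^ r) ^ (1 / r), ?_, ?_⟩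
  · have h1 : Tendsto (fun c => b ^ 2 / (α c + e) ^ 2) atTop (𝓝 (b ^ 2 / (0 + e) ^ 2)) :=
      tendsto_const_nhds.div ((hα1.add_const e).pow 2) (by positivity)
    have h2 := hα2.rpow_const (p := 1 / r) (Or.inl one_ne_zero)
    simpa using h1.mul h2
  filter_upwards [hα1.eventually_lt_const he0, (tendsto_rpow_neg_atTop hν).eventually_lt_const
    one_pos, eventually_gt_atTop 0] with c hc hs1 hc0
  have hs0 : 0 < c ^ (-ν) := by positivity
  have hcr : 0 < c ^ r := by positivity
  have hα0 : 0 < α c := by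
    have : 0 < 1 - c ^ (-ν) := by linarith
    simp only [hα]
    positivity
  rw [meanEntry_testDiag hs0.le hs1.le hc0 hr.ne, ← he, ← hb]
  obtain ⟨x, y, w, hy0, hy, hy', hx, hx', hw1, hw, hw', hf⟩ := exists_entry_of_lt hα0
    hc (sqrt_mul_sq_lt hs0.le hs1.le he0 hcr (half_sub_sq_lt r))
  rw [hf]
  have hx0 : 0 < x := by linarith
  have h1 : c * (α c / c ^ r) ^ (1 / r) ≤ y ^ (1 / r) := by
    refine le_trans (le_of_eq ?_) (Real.rpow_le_rpow_of_nonpos hy0 hy (one_div_neg.mpr hr).le)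
    rw [Real.div_rpow hα0.le hcr.le, ← Real.rpow_mul hc0.le, mul_one_div_cancel hr.ne,
      Real.rpow_one]
    field_simp
  rw [mul_pow √(c ^ (-ν)), Real.sq_sqrt hs0.le] at hw
  have h3 : 0 ≤ (1 - w) * x ^ (1 / r) := mul_nonneg (by linarith) (by positivity)
  calc _ = c ^ (-ν) * b ^ 2 / (α c + e) ^ 2 * (c * (α c / c ^ r) ^ (1 / r)) := by
        rw [sub_eq_add_neg, Real.rpow_add hc0, Real.rpow_one]; ring
    _ ≤ w * y ^ (1 / r) := mul_le_mul hw h1 (by positivity) (le_trans (by positivity) hw)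
    _ ≤ _ := by linarith

open Filter Topology in
/-- For `-ν < r < 0`, an upper bound for the entry which is asymptotically sharp. -/
theorem eventually_meanEntry_div_le {r ν : ℝ} (hr : r < 0) (hν : 0 < ν) (hν1 : ν < 1)
    (hrν : -r < ν) :
    ∃ U : ℝ → ℝ, Tendsto U atTop (𝓝 (((2 ^ r - 1) / 2) ^ 2 / ((2 ^ r + 1) / 2) ^ 2)) ∧
      ∀ᶠ c : ℝ in atTop, meanEntry (c ^ (-ν)) (testDiag c) r ≤ U c * c ^ (1 - ν) := by
  set e : ℝ := (2 ^ r + 1) / 2 with he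
  set b : ℝ := (2 ^ r - 1) / 2 with hb
  have he0 : 0 < e := by positivity
  set α : ℝ → ℝ := fun c => c ^ (-ν) * e + (1 - c ^ (-ν)) * c ^ r with hα
  have hα1 : Tendsto α atTop (𝓝 0) := tendsto_smaller_entry e hr hν
  have hα2 : Tendsto (fun c => α c / c ^ r) atTop (𝓝 1) := tendsto_smaller_entry_div e hν hrν
  -- The lower bound `α - s b² / (e - α)` for the small eigenvalue, divided by `c^r`.
  set m : ℝ → ℝ := fun c => α c / c ^ r - c ^ (-(ν + r)) * (b ^ 2 / (e - α c)) with hm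
  have hm1 : Tendsto m atTop (𝓝 1) := by
    have h1 : Tendsto (fun c => b ^ 2 / (e - α c)) atTop (𝓝 (b ^ 2 / (e - 0))) :=
      tendsto_const_nhds.div (hα1.const_sub e) (by simpa using he0.ne')
    have h2 := hα2.sub ((tendsto_rpow_neg_atTop (by linarith : 0 < ν + r)).mul h1)
    rwa [mul_comm (0 : ℝ), mul_zero, sub_zero] at h2
  -- The second summand bounds the share of the large eigenvalue and vanishes in the limit because
  -- `ν < 1`.
  refine ⟨fun c => b ^ 2 / (e - α c) ^ 2 * m c ^ (1 / r) + e ^ (1 / r) * c ^ (-(1 - ν)), ?_, ?_⟩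
  · have h1 : Tendsto (fun c => b ^ 2 / (e - α c) ^ 2) atTop (𝓝 (b ^ 2 / (e - 0) ^ 2)) :=
      tendsto_const_nhds.div ((hα1.const_sub e).pow 2) (by simpa using he0.ne')
    have h2 := hm1.rpow_const (p := 1 / r) (Or.inl one_ne_zero)
    have h3 := (tendsto_rpow_neg_atTop (by linarith : 0 < 1 - ν)).const_mul (e ^ (1 / r))
    simpa using (h1.mul h2).add h3
  filter_upwards [hα1.eventually_lt_const he0, (tendsto_rpow_neg_atTop hν).eventually_lt_const
    one_pos, eventually_gt_atTop 0, hm1.eventually_const_lt one_pos] with c hc hs1 hc0 hm0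
  have hs0 : 0 < c ^ (-ν) := by positivity
  have hcr : 0 < c ^ r := by positivity
  have hα0 : 0 < α c := by
    have : 0 < 1 - c ^ (-ν) := by linarith
    simp only [hα]
    positivity
  rw [meanEntry_testDiag hs0.le hs1.le hc0 hr.ne, ← he, ← hb]
  obtain ⟨x, y, w, hy0, hy, hy', hx, hx', hw1, hw, hw', hf⟩ := exists_entry_of_lt hα0
    hc (sqrt_mul_sq_lt hs0.le hs1.le he0 hcr (half_sub_sq_lt r))
  rw [hf]
  rw [mul_pow √(c ^ (-ν)), Real.sq_sqrt hs0.le] at hw' hy'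
  have hw0 : 0 ≤ w := le_trans (by positivity) hw
  have hmy : m c * c ^ r ≤ y := by
    refine le_trans (le_of_eq ?_) hy'
    simp only [hm]
    rw [neg_add, Real.rpow_add hc0, Real.rpow_neg hc0.le r, ← hb]
    have : e - α c ≠ 0 := (sub_pos.mpr hc).ne'
    field_simp
  have h1 : y ^ (1 / r) ≤ m c ^ (1 / r) * c := by
    refine (Real.rpow_le_rpow_of_nonpos (by positivity) hmy (one_div_neg.mpr hr).le).trans
      (le_of_eq ?_)
    rw [Real.mul_rpow hm0.le hcr.le, ← Real.rpow_mul hc0.le, mul_one_div_cancel hr.ne,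
      Real.rpow_one]
  have h2 : x ^ (1 / r) ≤ e ^ (1 / r) :=
    Real.rpow_le_rpow_of_nonpos he0 hx (one_div_neg.mpr hr).le
  have hx0 : 0 < x := by linarith
  have h3 : (1 - w) * x ^ (1 / r) ≤ e ^ (1 / r) :=
    (mul_le_of_le_one_left (by positivity) (by linarith)).trans h2
  have h4 : w * y ^ (1 / r) ≤ c ^ (-ν) * b ^ 2 / (e - α c) ^ 2 * (m c ^ (1 / r) * c) :=
    mul_le_mul hw' h1 (by positivity) (le_trans hw0 hw')
  refine (add_le_add h4 h3).trans (le_of_eq ?_)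
  have h5 : c ^ (-(1 - ν)) * c ^ (1 - ν) = 1 := by
    rw [← Real.rpow_add hc0, neg_add_cancel, Real.rpow_zero]
  rw [add_mul, mul_assoc (e ^ (1 / r)), h5, sub_eq_add_neg 1 ν, Real.rpow_add hc0, Real.rpow_one]
  ring

open Filter Topology in
theorem not_powerMeanLE_of_neg {p q : ℝ} (hp : -1 < p) (hpq : p < q) (hq : q < 0) :
    ¬ PowerMeanLE p q := by
  intro h
  -- The exponent `ν` is the midpoint of `-p` and `1`, so `-q < -p < ν < 1` and both asymptotics
  -- apply.
  have hν : 0 < (1 - p) / 2 := by linarith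
  obtain ⟨L, hL, hL'⟩ := eventually_le_meanEntry_div (hpq.trans hq) hν (by linarith)
  obtain ⟨U, hU, hU'⟩ := eventually_meanEntry_div_le hq hν (by linarith) (by linarith)
  have hle := le_of_tendsto_of_tendsto hL hU (by
    filter_upwards [hL', hU', eventually_gt_atTop 0,
      (tendsto_rpow_neg_atTop hν).eventually_lt_const one_pos] with c h1 h2 hc0 hs1
    exact le_of_mul_le_mul_right (h1.trans ((h.meanEntry_le (by positivity) hs1.le
      (testDiag_pos hc0)).trans h2)) (Real.rpow_pos_of_pos hc0 (1 - (1 - p) / 2)))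
  have hx : (0 : ℝ) < 2 ^ p := by positivity
  have hxy : (2 : ℝ) ^ p < 2 ^ q := Real.rpow_lt_rpow_of_exponent_lt one_lt_two hpq
  have hy : (2 : ℝ) ^ q < 1 := Real.rpow_lt_one_of_one_lt_of_neg one_lt_two hq
  generalize (2 : ℝ) ^ p = x at hle hx hxy
  generalize (2 : ℝ) ^ q = y at hle hxy hy
  -- The limit `((1 - t) / (1 + t))²` is strictly decreasing in `t = 2^r ∈ (0, 1)`, contrary to
  -- `hle`.
  have hxy' : (1 - y) * (x + 1) < (1 - x) * (y + 1) := by linarith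
  have hsq := pow_lt_pow_left₀ hxy' (mul_nonneg (by linarith) (by linarith)) two_ne_zero
  have hx1 : 0 < x + 1 := by linarith
  have hy1 : 0 < y + 1 := by linarith
  rw [div_le_div_iff₀ (by positivity) (by positivity)] at hle
  linarith

/-! ### Assembling the cases -/

theorem theorem2p4 (p q : ℝ)
    (h : ∀ Φ : Matrix (Fin 3) (Fin 3) ℂ →CP Matrix (Fin 2) (Fin 2) ℂ, Φ 1 = 1 →
      ∀ A : Matrix (Fin 3) (Fin 3) ℂ, A.PosDef → powerMean Φ p A ≤ powerMean Φ q A) :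
    p = q ∨
    (1 ≤ p ∧ p < q) ∨
    (p < q ∧ q ≤ -1) ∨
    (p ≤ -1 ∧ 1 ≤ q) ∨
    (1 / 2 ≤ p ∧ p < 1 ∧ 1 ≤ q) ∨
    (p ≤ -1 ∧ -1 < q ∧ q ≤ -1 / 2) := by
  have h : PowerMeanLE p q := h
  rcases h.le.eq_or_lt with hpq | hpq
  · exact Or.inl hpq
  have key : ∀ {p q : ℝ}, PowerMeanLE p q → p < q → p ≤ -1 ∨ 1 / 2 ≤ p := by
    intro p q h hpq
    by_contra! hp
    rcases lt_trichotomy q 0 with hq | rfl | hq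
    · exact not_powerMeanLE_of_neg hp.1 hpq hq h
    -- Inversion turns `(p, 0)` into `(0, -p)`, whose second exponent is positive.
    · have hneg := h.neg
      rw [neg_zero] at hneg
      exact not_powerMeanLE_of_pos (by norm_num) (by norm_num) (by linarith) (by linarith) hneg
    · exact not_powerMeanLE_of_pos hp.1 hp.2 hpq hq h
  have h1 := key h hpq
  -- This gives `1 ≤ q` or `q ≤ -1/2`; intersecting with `h1` and `p < q` leaves the listed cases.
  have h2 := key h.neg (neg_lt_neg hpq)
  grind
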